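/- Let $a,b\in\mathbb{C}$ and consider the $2$-periodic Lyness recurrence $$x_{n+2}=\frac{a_n+x_{n+1}}{x_n},\qquad n\ge 1,\qquad\text{where } a_n=a \text{ for odd } n \text{ and } a_n=b \text{ for even } n,$$ with complex initial conditions $x_1,x_2$. A sequence $(x_n)_{n\ge1}$ generated by it is well defined if $x_n\neq 0$ for all $n\ge1$. For a positive integer $p$, the recurrence is called globally $p$-periodic if $p$ is the smallest positive integer such that $x_{n+p}=x_n$ for all $n\ge 1$ and for every well-defined sequence $(x_n)_{n\ge1}$ of the recurrence; it is called globally periodic if it is globally $p$-periodic for some $p$. Theorem. The only globally periodic recurrences of this family are: (i) the cases $a=b=0$, which is globally $6$-periodic, and $a=b=1$, which is globally $5$-periodic; (ii) the cases $a=(-1\pm i\sqrt3)/2$ and $b=\overline a=1/a$, which are globally $10$-periodic. -/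

import Mathlib

/-- The coefficients of the `2`-periodic Lyness recurrence: `a` for odd `n`, `b` for even `n`. -/
def lynessCoeff (a b : ℂ) (n : ℕ) : ℂ := if Odd n then a else b

/-- `x 1, x 2, x 3, …` is a well-defined sequence of the recurrence
`x (n + 2) = (a_n + x (n + 1)) / x n`: no denominator vanishes and the recurrence holds
for every `n ≥ 1`. The initial conditions are `x 1` and `x 2`; the value `x 0` plays no role. -/
def IsLynessSequence (a b : ℂ) (x : ℕ → ℂ) : Prop :=
  ∀ n, 1 ≤ n → x n ≠ 0 ∧ x (n + 2) = (lynessCoeff a b n + x (n + 1)) / x n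

/-- `p` is a positive period of every well-defined sequence of the recurrence. -/
def IsCommonLynessPeriod (a b : ℂ) (p : ℕ) : Prop :=
  0 < p ∧ ∀ x : ℕ → ℂ, IsLynessSequence a b x → ∀ n, 1 ≤ n → x (n + p) = x n

/-- The recurrence is globally `p`-periodic: `p` is the smallest positive integer that is a
period of the sequences of all initial conditions for which the sequence is well defined. -/
def IsGloballyPeriodicLyness (a b : ℂ) (p : ℕ) : Prop :=
  IsLeast {q : ℕ | IsCommonLynessPeriod a b q} p

/-!
The exclusion of all other parameters rests on linearising the recurrence at its `2`-periodic
solutions `x, y, x, y, …`, that is, at the solutions of `x² = a + y`, `y² = b + x` with `xy ≠ 0`.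

* If `p` is a period of every well-defined sequence, then it is a period of every solution of the
  linearised recurrence along a given well-defined sequence
  (`IsCommonLynessPeriod.variation_periodic`). Perturbing the initial conditions along a complex
  line, each term is a rational function of the parameter `t` that does not vanish at `t = 0`, so
  only countably many `t` are lost and the identity between terms may be differentiated at `0`.
* Along `x, y, x, y, …` the two-step monodromy has determinant `1` and trace `1 / (xy) - 2`.
  Its finite order forces `xy` to be real with `xy > 1 / 4`
  (`IsCommonLynessPeriod.exists_real_mul_eq`).
* The abscissae of the fixed points are the roots of `P = (X² - a)² - b - X`, and
  `P'(x) = 4xy - 1`. If no root had `xy = 0`, all `P'(x)` would be positive, against the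
  identity `∑ 1 / P'(x) = 0` over the simple roots of a polynomial of degree at least `2`. Hence
  some root has `xy = 0`, which means `b = a²` or `a = b²`.
* If `b = a²`, the nonzero abscissae are the roots of `X³ - 2aX - 1`, where `xy = ax + 1`. Unless
  `a = 0` or `a³ = 1`, the real numbers `t = ax` are the three roots of `T³ - 2cT - c` with
  `c = a³`, all larger than `-3 / 4`; this gives `c < 27 / 32`, whereas the discriminant of a
  cubic with real roots is nonnegative, which gives `c ≥ 27 / 32`.

Conversely, for `b = a²` and `a³ = 1` five steps of the recurrence only multiply `x n` by the
coefficient with index `n + 1` (`IsLynessSequence.add_five`), so `10`, and for `a = 1` already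
`5`, is a period; for `a = b = 0` the period `6` is immediate. Explicit orbits show that no
smaller number is a common period.
-/

/-! ### Roots of cubics and quartics -/

/-- A monic cubic over `ℂ` has three roots, described by Vieta's formulas. -/
lemma exists_cubic_roots (c₂ c₁ c₀ : ℂ) : ∃ r s t : ℂ,
    r + s + t = -c₂ ∧ r * s + r * t + s * t = c₁ ∧ r * s * t = -c₀ := by
  have h1 : (⟨1, c₂, c₁, c₀⟩ : Cubic ℂ).a ≠ 0 := one_ne_zero
  obtain ⟨r, s, t, h⟩ := (Cubic.splits_iff_roots_eq_three (φ := RingHom.id ℂ) h1).1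
    (IsAlgClosed.splits _)
  have hb := Cubic.b_eq_three_roots h1 h
  have hc := Cubic.c_eq_three_roots h1 h
  have hd := Cubic.d_eq_three_roots h1 h
  simp only [RingHom.id_apply] at hb hc hd
  exact ⟨r, s, t, by linear_combination hb, by linear_combination -hc,
    by linear_combination hd⟩

open Polynomial in
/-- A monic quartic over `ℂ` has four roots, described by Vieta's formulas. -/
lemma exists_quartic_roots (c₃ c₂ c₁ c₀ : ℂ) : ∃ r s t u : ℂ,
    r + s + t + u = -c₃ ∧ r * s + r * t + r * u + s * t + s * u + t * u = c₂ ∧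
    r * s * t + r * s * u + r * t * u + s * t * u = -c₁ ∧ r * s * t * u = c₀ := by
  obtain ⟨r, hr⟩ := IsAlgClosed.exists_root
    (X ^ 4 + C c₃ * X ^ 3 + C c₂ * X ^ 2 + C c₁ * X + C c₀) (by
      have : (X ^ 4 + C c₃ * X ^ 3 + C c₂ * X ^ 2 + C c₁ * X + C c₀ : ℂ[X]).degree = 4 := by
        compute_degree!
      rw [this]
      decide)
  simp only [IsRoot.def, eval_add, eval_pow, eval_X, eval_mul, eval_C] at hr
  -- The other three are the roots of the quotient by `X - r`.
  obtain ⟨s, t, u, h1, h2, h3⟩ := exists_cubic_roots (c₃ + r) (c₂ + r * (c₃ + r))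
    (c₁ + r * (c₂ + r * (c₃ + r)))
  exact ⟨r, s, t, u, by linear_combination h1, by linear_combination h2 + r * h1,
    by linear_combination h3 + r * h2, by linear_combination r * h3 - hr⟩

/-- The sum of `1 / P'(z)` over the roots `z` of a quartic `P` vanishes, so the values of `P'` at
the roots cannot all be positive. -/
lemma not_all_pos_quartic_derivative {r s t u : ℂ} {d₁ d₂ d₃ d₄ : ℝ}
    (h₁ : 0 < d₁) (h₂ : 0 < d₂) (h₃ : 0 < d₃) (h₄ : 0 < d₄)
    (e₁ : (r - s) * (r - t) * (r - u) = d₁) (e₂ : (s - r) * (s - t) * (s - u) = d₂)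
    (e₃ : (t - r) * (t - s) * (t - u) = d₃) (e₄ : (u - r) * (u - s) * (u - t) = d₄) : False := by
  have key : ((1 / d₁ + 1 / d₂ + 1 / d₃ + 1 / d₄ : ℝ) : ℂ) = 0 := by
    have n₁ : (r - s) * (r - t) * (r - u) ≠ 0 := by rw [e₁]; exact_mod_cast h₁.ne'
    have n₂ : (s - r) * (s - t) * (s - u) ≠ 0 := by rw [e₂]; exact_mod_cast h₂.ne'
    have n₃ : (t - r) * (t - s) * (t - u) ≠ 0 := by rw [e₃]; exact_mod_cast h₃.ne'
    have n₄ : (u - r) * (u - s) * (u - t) ≠ 0 := by rw [e₄]; exact_mod_cast h₄.ne'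
    push_cast
    rw [← e₁, ← e₂, ← e₃, ← e₄]
    simp only [mul_ne_zero_iff] at n₁ n₂ n₃ n₄
    obtain ⟨⟨rs, rt⟩, ru⟩ := n₁
    obtain ⟨⟨-, st⟩, su⟩ := n₂
    have tu := n₃.2
    rw [← neg_sub r s, ← neg_sub r t, ← neg_sub r u, ← neg_sub s t, ← neg_sub s u, ← neg_sub t u]
    field_simp
    ring
  have : (1 / d₁ + 1 / d₂ + 1 / d₃ + 1 / d₄ : ℝ) = 0 := by exact_mod_cast key
  have : 0 < 1 / d₁ + 1 / d₂ + 1 / d₃ + 1 / d₄ := by positivity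
  linarith

/-- The cubic `T ^ 3 - 2 * c * T - c` with `c ≠ 0` does not have three real roots larger than
`-3 / 4`. -/
lemma mul_roots_eq_zero_of_depressed_cubic {t₁ t₂ t₃ : ℝ}
    (h₁ : -3 / 4 < t₁) (h₂ : -3 / 4 < t₂) (h₃ : -3 / 4 < t₃)
    (e₁ : t₁ + t₂ + t₃ = 0) (e₂ : t₁ * t₂ + t₁ * t₃ + t₂ * t₃ = -2 * (t₁ * t₂ * t₃)) :
    t₁ * t₂ * t₃ = 0 := by
  by_contra hc
  set c := t₁ * t₂ * t₃ with hcdef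
  have upper : c < 27 / 32 := by
    have : 0 < (t₁ + 3 / 4) * (t₂ + 3 / 4) * (t₃ + 3 / 4) :=
      mul_pos (mul_pos (by linarith) (by linarith)) (by linarith)
    have e : (t₁ + 3 / 4) * (t₂ + 3 / 4) * (t₃ + 3 / 4) = 27 / 64 - c / 2 := by
      linear_combination (3 / 4) * e₂ + (9 / 16) * e₁
    linarith
  -- The left-hand side is the discriminant.
  have disc : ((t₁ - t₂) * (t₁ - t₃) * (t₂ - t₃)) ^ 2 = c ^ 2 * (32 * c - 27) := by
    have ht : t₃ = -t₁ - t₂ := by linarith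
    have e : -4 * (t₁ * t₂ + t₁ * t₃ + t₂ * t₃) ^ 3 - 27 * (t₁ * t₂ * t₃) ^ 2 =
        ((t₁ - t₂) * (t₁ - t₃) * (t₂ - t₃)) ^ 2 := by
      rw [ht]; ring
    rw [← e, e₂]
    ring
  have hc2 : 0 < c ^ 2 := by positivity
  have := sq_nonneg ((t₁ - t₂) * (t₁ - t₃) * (t₂ - t₃))
  rw [disc] at this
  nlinarith [mul_pos hc2 (by linarith : 0 < 27 - 32 * c)]

/-! ### Parameters with elliptic fixed points -/

/-- Every `2`-periodic solution `x, y, x, y, …` of the recurrence has `xy` real and larger than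
`1 / 4`. Equivalently, the derivative of the two-step map at each of its fixed points with nonzero
coordinates has two distinct eigenvalues on the unit circle. -/
def EllipticFixedPoints (a b : ℂ) : Prop :=
  ∀ x y : ℂ, x ^ 2 = a + y → y ^ 2 = b + x → x * y ≠ 0 → ∃ s : ℝ, 1 / 4 < s ∧ x * y = s

lemma EllipticFixedPoints.symm {a b : ℂ} (h : EllipticFixedPoints a b) :
    EllipticFixedPoints b a := by
  intro x y hx hy hxy
  rw [mul_comm] at hxy ⊢
  exact h y x hy hx hxy

/-- One of the four roots of `(X ^ 2 - a) ^ 2 - b - X` must give a fixed point on a coordinate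
axis, since otherwise the derivative `4 * x * y - 1` would be positive at all of them. -/
lemma EllipticFixedPoints.eq_sq_or_eq_sq {a b : ℂ} (h : EllipticFixedPoints a b) :
    b = a ^ 2 ∨ a = b ^ 2 := by
  obtain ⟨r, s, t, u, h1, h2, h3, h4⟩ := exists_quartic_roots 0 (-2 * a) (-1) (a ^ 2 - b)
  by_contra! hne
  have pos : ∀ z : ℂ, (z ^ 2 - a) ^ 2 = b + z → ∃ d : ℝ, 0 < d ∧ 4 * z * (z ^ 2 - a) - 1 = d := by
    intro z hz
    obtain ⟨q, hq, e⟩ := h z (z ^ 2 - a) (by ring) hz (by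
      intro h0
      rcases mul_eq_zero.1 h0 with h0 | h0
      · rw [h0] at hz
        exact hne.1 (by linear_combination -hz)
      · rw [h0] at hz
        have hb : b = -z := by linear_combination -hz
        exact hne.2 (by rw [hb]; linear_combination -h0))
    exact ⟨4 * q - 1, by linarith, by push_cast; linear_combination 4 * e⟩
  obtain ⟨d₁, p₁, e₁⟩ := pos r (by
    linear_combination r ^ 3 * h1 - r ^ 2 * h2 + r * h3 - h4)
  obtain ⟨d₂, p₂, e₂⟩ := pos s (by
    linear_combination s ^ 3 * h1 - s ^ 2 * h2 + s * h3 - h4)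
  obtain ⟨d₃, p₃, e₃⟩ := pos t (by
    linear_combination t ^ 3 * h1 - t ^ 2 * h2 + t * h3 - h4)
  obtain ⟨d₄, p₄, e₄⟩ := pos u (by
    linear_combination u ^ 3 * h1 - u ^ 2 * h2 + u * h3 - h4)
  refine not_all_pos_quartic_derivative (r := r) (s := s) (t := t) (u := u) p₁ p₂ p₃ p₄
    ?_ ?_ ?_ ?_
  · rw [← e₁]; linear_combination -3 * r ^ 2 * h1 + 2 * r * h2 - h3
  · rw [← e₂]; linear_combination -3 * s ^ 2 * h1 + 2 * s * h2 - h3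
  · rw [← e₃]; linear_combination -3 * t ^ 2 * h1 + 2 * t * h2 - h3
  · rw [← e₄]; linear_combination -3 * u ^ 2 * h1 + 2 * u * h2 - h3

/-- When `b = a ^ 2`, one fixed point is `(0, -a)` and the abscissae of the others are the roots of
`X ^ 3 - 2 * a * X - 1`. -/
lemma EllipticFixedPoints.eq_zero_or_cube_eq_one {a : ℂ} (h : EllipticFixedPoints a (a ^ 2)) :
    a = 0 ∨ a ^ 3 = 1 := by
  by_contra! hne
  obtain ⟨r, s, t, h1, h2, h3⟩ := exists_cubic_roots 0 (-2 * a) (-1)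
  -- At a root `z`, the fixed point `(z, z ^ 2 - a)` has product of coordinates `a * z + 1`.
  have real : ∀ z : ℂ, z ^ 3 - 2 * a * z - 1 = 0 → ∃ q : ℝ, -3 / 4 < q ∧ a * z = q := by
    intro z hz
    obtain ⟨q, hq, e⟩ := h z (z ^ 2 - a) (by ring) (by linear_combination z * hz) (by
      intro h0
      rcases mul_eq_zero.1 h0 with h0 | h0
      · rw [h0] at hz
        norm_num at hz
      · have haz : a * z = -1 := by linear_combination z * h0 - hz
        exact hne.2 (by linear_combination (a * z - 1) * haz - a ^ 2 * h0))
    exact ⟨q - 1, by linarith, by push_cast; linear_combination e - hz⟩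
  obtain ⟨t₁, p₁, e₁⟩ := real r (by linear_combination r ^ 2 * h1 - r * h2 + h3)
  obtain ⟨t₂, p₂, e₂⟩ := real s (by linear_combination s ^ 2 * h1 - s * h2 + h3)
  obtain ⟨t₃, p₃, e₃⟩ := real t (by linear_combination t ^ 2 * h1 - t * h2 + h3)
  have hprod : (t₁ * t₂ * t₃ : ℂ) = a ^ 3 := by
    rw [← e₁, ← e₂, ← e₃]; linear_combination a ^ 3 * h3
  have hsum : (t₁ + t₂ + t₃ : ℂ) = 0 := by
    rw [← e₁, ← e₂, ← e₃]; linear_combination a * h1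
  have hpair : (t₁ * t₂ + t₁ * t₃ + t₂ * t₃ : ℂ) = -2 * (t₁ * t₂ * t₃) := by
    rw [hprod, ← e₁, ← e₂, ← e₃]; linear_combination a ^ 2 * h2
  have := mul_roots_eq_zero_of_depressed_cubic p₁ p₂ p₃
    (by exact_mod_cast hsum) (by exact_mod_cast hpair)
  have h0 : (t₁ * t₂ * t₃ : ℂ) = 0 := by exact_mod_cast this
  exact hne.1 (pow_eq_zero_iff three_ne_zero |>.1 (hprod.symm.trans h0))

lemma EllipticFixedPoints.classify {a b : ℂ} (h : EllipticFixedPoints a b) :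
    (a = 0 ∧ b = 0) ∨ (a ^ 3 = 1 ∧ b = a ^ 2) := by
  rcases h.eq_sq_or_eq_sq with rfl | rfl
  · rcases h.eq_zero_or_cube_eq_one with rfl | h
    · simp
    · exact Or.inr ⟨h, rfl⟩
  · rcases h.symm.eq_zero_or_cube_eq_one with rfl | h
    · simp
    · exact Or.inr ⟨by linear_combination (b ^ 3 + 1) * h, by linear_combination -b * h⟩

/-! ### Linearisation of the recurrence -/

/-- The sequence of the recurrence with initial conditions `u`, `v` in the positions `1`, `2`;
division by zero gives `0`, so it is defined for all initial conditions. -/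
noncomputable def lynessOrbit (a b u v : ℂ) : ℕ → ℂ
  | 0 => 0
  | 1 => u
  | 2 => v
  | n + 3 => (lynessCoeff a b (n + 1) + lynessOrbit a b u v (n + 2)) / lynessOrbit a b u v (n + 1)

lemma isLynessSequence_lynessOrbit {a b u v : ℂ} (h : ∀ n, 1 ≤ n → lynessOrbit a b u v n ≠ 0) :
    IsLynessSequence a b (lynessOrbit a b u v) := by
  intro n hn
  obtain ⟨m, rfl⟩ := Nat.exists_eq_add_of_le' hn
  exact ⟨h _ hn, by rw [lynessOrbit]⟩

lemma IsLynessSequence.lynessOrbit_eq {a b : ℂ} {x : ℕ → ℂ} (hx : IsLynessSequence a b x) :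
    ∀ n, lynessOrbit a b (x 1) (x 2) (n + 1) = x (n + 1)
  | 0 => rfl
  | 1 => rfl
  | n + 2 => by
    rw [lynessOrbit, hx.lynessOrbit_eq n, hx.lynessOrbit_eq (n + 1)]
    exact ((hx (n + 1) (by omega)).2).symm

open Polynomial in
/-- When the initial conditions move along a complex line, each term is a fraction of two
polynomials in the parameter, at all parameters for which the term makes sense. -/
lemma exists_lynessOrbit_line_eq_fraction (a b u v u' v' : ℂ) : ∀ n, ∃ P Q : ℂ[X], ∀ t : ℂ,
    (∀ k < n, lynessOrbit a b (u + t * u') (v + t * v') (k + 1) ≠ 0) →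
      Q.eval t ≠ 0 ∧
        lynessOrbit a b (u + t * u') (v + t * v') (n + 1) * Q.eval t = P.eval t
  | 0 => ⟨C u + X * C u', 1, fun t _ => by simp [lynessOrbit]; ring⟩
  | 1 => ⟨C v + X * C v', 1, fun t _ => by simp [lynessOrbit]; ring⟩
  | n + 2 => by
    obtain ⟨P₁, Q₁, h₁⟩ := exists_lynessOrbit_line_eq_fraction a b u v u' v' n
    obtain ⟨P₂, Q₂, h₂⟩ := exists_lynessOrbit_line_eq_fraction a b u v u' v' (n + 1)
    refine ⟨(C (lynessCoeff a b (n + 1)) * Q₂ + P₂) * Q₁, Q₂ * P₁, fun t ht => ?_⟩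
    obtain ⟨q₁, e₁⟩ := h₁ t fun k hk => ht k (by omega)
    obtain ⟨q₂, e₂⟩ := h₂ t fun k hk => ht k (by omega)
    have hn := ht n (by omega)
    rw [lynessOrbit]
    simp only [eval_mul, eval_add, eval_C, ← e₁, ← e₂]
    refine ⟨mul_ne_zero q₂ (mul_ne_zero hn q₁), ?_⟩
    field_simp

open Polynomial in
/-- On a complex line of initial conditions through a well-defined sequence, at most countably
many are not well defined. -/
lemma countable_lynessOrbit_line_singular {a b : ℂ} {x : ℕ → ℂ} (hx : IsLynessSequence a b x)
    (u' v' : ℂ) :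
    {t : ℂ | ∃ n, lynessOrbit a b (x 1 + t * u') (x 2 + t * v') (n + 1) = 0}.Countable := by
  choose P Q hPQ using exists_lynessOrbit_line_eq_fraction a b (x 1) (x 2) u' v'
  have hP : ∀ n, P n ≠ 0 := by
    intro n h0
    have hne : ∀ k, lynessOrbit a b (x 1 + 0 * u') (x 2 + 0 * v') (k + 1) ≠ 0 := by
      intro k
      simpa [hx.lynessOrbit_eq] using (hx (k + 1) (by omega)).1
    obtain ⟨hq, e⟩ := hPQ n 0 fun k _ => hne k
    rw [h0, eval_zero] at e
    exact mul_ne_zero (hne n) hq e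
  refine (Set.countable_iUnion fun n => ((P n).rootSet_finite ℂ).countable).mono ?_
  rintro t ⟨n, hn⟩
  -- The first vanishing term is a root of its numerator.
  classical
  have hex : ∃ n, lynessOrbit a b (x 1 + t * u') (x 2 + t * v') (n + 1) = 0 := ⟨n, hn⟩
  obtain ⟨-, e⟩ := hPQ (Nat.find hex) t fun k hk => Nat.find_min hex hk
  rw [Nat.find_spec hex, zero_mul] at e
  refine Set.mem_iUnion.2 ⟨Nat.find hex, ?_⟩
  rw [mem_rootSet]
  exact ⟨hP _, by simpa using e.symm⟩

/-- The terms of the recurrence are differentiable in the initial conditions, and the derivative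
solves the linearised recurrence. -/
lemma IsLynessSequence.hasDerivAt_lynessOrbit {a b : ℂ} {x ξ : ℕ → ℂ}
    (hx : IsLynessSequence a b x)
    (hξ : ∀ n, 1 ≤ n → x n * ξ (n + 2) = ξ (n + 1) - x (n + 2) * ξ n) :
    ∀ n, HasDerivAt (fun t => lynessOrbit a b (x 1 + t * ξ 1) (x 2 + t * ξ 2) (n + 1))
      (ξ (n + 1)) 0
  | 0 => by simpa [lynessOrbit] using ((hasDerivAt_id (0 : ℂ)).mul_const (ξ 1)).const_add (x 1)
  | 1 => by simpa [lynessOrbit] using ((hasDerivAt_id (0 : ℂ)).mul_const (ξ 2)).const_add (x 2)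
  | n + 2 => by
    have h₁ := hx.hasDerivAt_lynessOrbit hξ n
    have h₂ := hx.hasDerivAt_lynessOrbit hξ (n + 1)
    have hne : x (n + 1) ≠ 0 := (hx (n + 1) (by omega)).1
    have h := (h₂.const_add (lynessCoeff a b (n + 1))).fun_div h₁ (by
      simpa [hx.lynessOrbit_eq] using hne)
    simp only [lynessOrbit]
    refine h.congr_deriv ?_
    have e := hξ (n + 1) (by omega)
    have e' := (hx (n + 1) (by omega)).2
    rw [eq_div_iff hne] at e'
    simp only [zero_mul, add_zero, hx.lynessOrbit_eq]
    rw [div_eq_iff (pow_ne_zero 2 hne)]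
    linear_combination -x (n + 1) * e + ξ (n + 1) * e'

/-- A common period of all well-defined sequences is a period of the solutions of the linearised
recurrence along any of them. -/
lemma IsCommonLynessPeriod.variation_periodic {a b : ℂ} {p : ℕ} (hp : IsCommonLynessPeriod a b p)
    {x ξ : ℕ → ℂ} (hx : IsLynessSequence a b x)
    (hξ : ∀ n, 1 ≤ n → x n * ξ (n + 2) = ξ (n + 1) - x (n + 2) * ξ n) {n : ℕ} (hn : 1 ≤ n) :
    ξ (n + p) = ξ n := by
  obtain ⟨m, rfl⟩ := Nat.exists_eq_add_of_le' hn
  set S := {t : ℂ | ∃ n, lynessOrbit a b (x 1 + t * ξ 1) (x 2 + t * ξ 2) (n + 1) = 0}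
  have hdense : Dense Sᶜ := (countable_lynessOrbit_line_singular hx (ξ 1) (ξ 2)).dense_compl ℂ
  have huniq : UniqueDiffWithinAt ℂ Sᶜ 0 := by
    rw [← uniqueDiffWithinAt_closure, hdense.closure_eq]
    exact uniqueDiffWithinAt_univ
  have h₁ := (hx.hasDerivAt_lynessOrbit hξ m).hasDerivWithinAt (s := Sᶜ)
  have h₂ := (hx.hasDerivAt_lynessOrbit hξ (m + p)).hasDerivWithinAt (s := Sᶜ)
  have heq : ∀ t ∈ Sᶜ, lynessOrbit a b (x 1 + t * ξ 1) (x 2 + t * ξ 2) (m + p + 1) =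
      lynessOrbit a b (x 1 + t * ξ 1) (x 2 + t * ξ 2) (m + 1) := by
    intro t ht
    have := hp.2 _ (isLynessSequence_lynessOrbit (a := a) (b := b)
      (u := x 1 + t * ξ 1) (v := x 2 + t * ξ 2) (fun n hn h0 => ht (by
        obtain ⟨k, rfl⟩ := Nat.exists_eq_add_of_le' hn
        exact ⟨k, h0⟩))) (m + 1) hn
    rwa [add_right_comm] at this
  have h₀ : (0 : ℂ) ∈ Sᶜ := by
    rintro ⟨k, hk⟩
    simp only [zero_mul, add_zero, hx.lynessOrbit_eq] at hk
    exact (hx (k + 1) (by omega)).1 hk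
  rw [add_right_comm]
  exact huniq.eq_deriv _ (h₂.congr (fun t ht => (heq t ht).symm) (heq 0 h₀).symm) h₁

/-! ### Multipliers of the fixed points -/

/-- The `2`-periodic sequence `x, y, x, y, …` with `x` in the odd positions. -/
def alternating (x y : ℂ) (n : ℕ) : ℂ := if Odd n then x else y

lemma isLynessSequence_alternating {a b x y : ℂ} (hx : x ^ 2 = a + y) (hy : y ^ 2 = b + x)
    (hxy : x * y ≠ 0) : IsLynessSequence a b (alternating x y) := by
  obtain ⟨hx0, hy0⟩ := mul_ne_zero_iff.1 hxy
  intro n _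
  rcases Nat.even_or_odd n with h | h
  · have h' : ¬ Odd n := Nat.not_odd_iff_even.2 h
    simp only [alternating, lynessCoeff, Nat.odd_add_one, h']
    refine ⟨by simpa using hy0, ?_⟩
    simp [eq_div_iff hy0, ← sq, hy]
  · simp only [alternating, lynessCoeff, Nat.odd_add_one, h]
    refine ⟨by simpa using hx0, ?_⟩
    simp [eq_div_iff hx0, ← sq, hx]

/-- A complex number of norm one and its inverse add up to a real number in `[-2, 2]`. -/
lemma exists_real_add_inv_of_norm_eq_one {z : ℂ} (hz : ‖z‖ = 1) :
    ∃ c : ℝ, |c| ≤ 2 ∧ z + z⁻¹ = c := by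
  refine ⟨2 * z.re, ?_, ?_⟩
  · rw [abs_mul, abs_two]
    linarith [Complex.abs_re_le_norm z]
  · rw [Complex.inv_eq_conj hz, Complex.add_conj]

/-- If the two-step map has eigenvalue `1` at a fixed point, then it is a nontrivial unipotent
there, so that no iterate has derivative `1`. -/
lemma IsCommonLynessPeriod.four_mul_ne_one {a b : ℂ} {p : ℕ} (hp : IsCommonLynessPeriod a b p)
    {x y : ℂ} (hx : x ^ 2 = a + y) (hy : y ^ 2 = b + x) (hxy : x * y ≠ 0) : 4 * (x * y) ≠ 1 := by
  intro h4
  -- The solution starting from the generalised eigenvector `(0, x)`, which grows linearly.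
  let ξ : ℕ → ℂ := fun n => if Odd n then ((n / 2 : ℕ) : ℂ) else (2 * ((n / 2 : ℕ) : ℂ) - 1) * x
  have hper := fun n => hp.variation_periodic (n := n) (ξ := ξ)
    (isLynessSequence_alternating hx hy hxy) (by
      intro n _
      obtain ⟨k, rfl | rfl⟩ := Nat.even_or_odd' n
      · have e₁ : (2 * k + 2) / 2 = k + 1 := by omega
        have e₂ : (2 * k + 1) / 2 = k := by omega
        have ho : ¬ Odd (2 * k) := by simp
        simp [ξ, alternating, Nat.odd_add_one, e₁, e₂, ho]
        linear_combination k * h4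
      · have e₁ : (2 * k + 1 + 2) / 2 = k + 1 := by omega
        have e₂ : (2 * k + 1) / 2 = k := by omega
        have e₃ : (2 * k + 1 + 1) / 2 = k + 1 := by omega
        simp [ξ, alternating, Nat.odd_add_one, e₁, e₂, e₃]
        ring)
  -- Two periods are used because `p` may be odd.
  have h : ξ (1 + p + p) = ξ 1 := (hper _ (by omega)).trans (hper 1 le_rfl)
  have e : (1 + p + p) / 2 = p := by omega
  have ho : Odd (1 + p + p) := ⟨p, by ring⟩
  simp only [ξ, ho, e] at h
  simp at h
  exact hp.1.ne' h

/-- The multipliers of the two-step map at a fixed point are mutually inverse with sum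
`1 / (xy) - 2`; being roots of unity, they have a real sum in `[-2, 2)`. -/
lemma IsCommonLynessPeriod.exists_real_mul_eq {a b : ℂ} {p : ℕ} (hp : IsCommonLynessPeriod a b p)
    {x y : ℂ} (hx : x ^ 2 = a + y) (hy : y ^ 2 = b + x) (hxy : x * y ≠ 0) :
    ∃ s : ℝ, 1 / 4 < s ∧ x * y = s := by
  set w := x * y with hw
  -- An eigenvalue `l` of the two-step map.
  obtain ⟨l, hl⟩ : ∃ l : ℂ, w * (1 + l) ^ 2 = l := by
    obtain ⟨d, hd⟩ := IsAlgClosed.exists_pow_nat_eq (1 - 4 * w) two_pos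
    refine ⟨(1 - 2 * w + d) / (2 * w), ?_⟩
    field_simp
    linear_combination hd
  have hl0 : l ≠ 0 := by
    rintro rfl
    exact hxy (by linear_combination hl)
  -- The solution starting from the multiple `(l, x * (1 + l) * l)` of the eigenvector `(1, x * (1 + l))`.
  let ξ : ℕ → ℂ := fun n => if Odd n then l * l ^ (n / 2) else x * (1 + l) * l ^ (n / 2)
  have hper := fun n => hp.variation_periodic (n := n) (ξ := ξ)
    (isLynessSequence_alternating hx hy hxy) (by
      intro n _
      obtain ⟨k, rfl | rfl⟩ := Nat.even_or_odd' n
      · have e₁ : (2 * k + 2) / 2 = k + 1 := by omega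
        have e₂ : (2 * k + 1) / 2 = k := by omega
        have ho : ¬ Odd (2 * k) := by simp
        simp [ξ, alternating, Nat.odd_add_one, e₁, e₂, ho]
        linear_combination l ^ k * hl - (1 + l) ^ 2 * l ^ k * hw
      · have e₁ : (2 * k + 1 + 2) / 2 = k + 1 := by omega
        have e₂ : (2 * k + 1) / 2 = k := by omega
        have e₃ : (2 * k + 1 + 1) / 2 = k + 1 := by omega
        simp [ξ, alternating, Nat.odd_add_one, e₁, e₂, e₃]
        ring)
  have h : ξ (1 + p + p) = ξ 1 := (hper _ (by omega)).trans (hper 1 le_rfl)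
  have e : (1 + p + p) / 2 = p := by omega
  have ho : Odd (1 + p + p) := ⟨p, by ring⟩
  simp only [ξ, ho, e] at h
  have hlp : l ^ p = 1 := by simpa [hl0] using h
  obtain ⟨c, hc, hlc⟩ := exists_real_add_inv_of_norm_eq_one
    (Complex.norm_eq_one_of_pow_eq_one hlp hp.1.ne')
  have hwc : w * ((c + 2 : ℝ) : ℂ) = 1 := by
    push_cast
    rw [← hlc]
    field_simp
    linear_combination hl
  have hc2 : c + 2 ≠ 0 := by
    intro h0
    simp [h0] at hwc
  have hws : w = ((1 / (c + 2) : ℝ) : ℂ) := by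
    have : ((c + 2 : ℝ) : ℂ) ≠ 0 := by exact_mod_cast hc2
    rw [Complex.ofReal_div, Complex.ofReal_one, eq_div_iff this, hwc]
  obtain ⟨hc₁, hc₃⟩ := abs_le.1 hc
  have hpos : 0 < c + 2 := lt_of_le_of_ne (by linarith) hc2.symm
  have hlt : c < 2 := lt_of_le_of_ne hc₃ (by
    rintro rfl
    refine hp.four_mul_ne_one hx hy hxy ?_
    push_cast at hwc
    linear_combination hwc)
  exact ⟨1 / (c + 2), by rw [one_div_lt_one_div (by norm_num) hpos]; linarith, hws⟩

/-! ### The periodic recurrences -/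

lemma IsLynessSequence.add_six {x : ℕ → ℂ} (hx : IsLynessSequence 0 0 x) {n : ℕ} (hn : 1 ≤ n) :
    x (n + 6) = x n := by
  have hc : ∀ m, lynessCoeff 0 0 m = 0 := fun m => by simp [lynessCoeff]
  have h : ∀ k, x (n + k + 2) = x (n + k + 1) / x (n + k) := fun k => by
    rw [(hx (n + k) (by omega)).2, hc, zero_add]
  have h0 := (hx n hn).1
  have h1 := (hx (n + 1) (by omega)).1
  have e2 := h 0
  have e3 := h 1
  have e4 := h 2
  have e5 := h 3
  have e6 := h 4
  simp only [add_assoc, Nat.reduceAdd, add_zero] at e2 e3 e4 e5 e6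
  rw [e6, e5, e4, e3, e2]
  field_simp

/-- If `b = a ^ 2` and `a ^ 3 = 1`, five steps of the recurrence multiply each term by a
coefficient, which is `1` when `a = 1`; the two coefficients have product `1`. -/
lemma IsLynessSequence.add_five {a : ℂ} (ha : a ^ 3 = 1) {x : ℕ → ℂ}
    (hx : IsLynessSequence a (a ^ 2) x) {n : ℕ} (hn : 1 ≤ n) :
    x (n + 5) = lynessCoeff a (a ^ 2) (n + 1) * x n := by
  obtain ⟨c, hc⟩ : ∃ c, c = lynessCoeff a (a ^ 2) n := ⟨_, rfl⟩
  have hcd : lynessCoeff a (a ^ 2) (n + 1) = c ^ 2 ∧ c ^ 3 = 1 := by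
    rw [hc]
    by_cases h : Odd n
    · simp [lynessCoeff, Nat.odd_add_one, h, ha]
    · simp only [lynessCoeff, Nat.odd_add_one, h]
      exact ⟨by simp; linear_combination -a * ha, by simp; linear_combination (a ^ 3 + 1) * ha⟩
  obtain ⟨hd, hc3⟩ := hcd
  have hper : ∀ m, lynessCoeff a (a ^ 2) (m + 2) = lynessCoeff a (a ^ 2) m := fun m => by
    simp [lynessCoeff, Nat.odd_add_one, parity_simps]
  have h0 := (hx n hn).1
  have h1 := (hx (n + 1) (by omega)).1
  have h2 := (hx (n + 2) (by omega)).1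
  have h3 := (hx (n + 3) (by omega)).1
  have e2 := (hx n hn).2
  have e3 := (hx (n + 1) (by omega)).2
  have e4 := (hx (n + 2) (by omega)).2
  have e5 := (hx (n + 3) (by omega)).2
  have hd' : lynessCoeff a (a ^ 2) (n + 3) = c ^ 2 := (hper (n + 1)).trans hd
  rw [hper, ← hc] at e4
  rw [hd'] at e5
  rw [hd] at e3 ⊢
  rw [← hc] at e2
  simp only [add_assoc, Nat.reduceAdd] at e2 e3 e4 e5
  rw [eq_div_iff h0] at e2
  rw [eq_div_iff h1] at e3
  rw [eq_div_iff h2] at e4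
  rw [eq_div_iff h3] at e5
  -- The factor `x (n + 2)` cancels from the expression of `x (n + 4)` by `x n` and `x (n + 1)`.
  have e4' : x (n + 4) * x (n + 1) = c * x n + 1 := by
    refine mul_right_cancel₀ h2 ?_
    refine mul_right_cancel₀ h0 ?_
    linear_combination x (n + 1) * x n * e4 + x n * e3 - (c * x n) * e2
  refine mul_right_cancel₀ h3 ?_
  refine mul_right_cancel₀ h1 ?_
  linear_combination x (n + 1) * e5 + e4' - c ^ 2 * x n * e3 - c ^ 2 * e2 - (c * x n + 1) * hc3

/-- A periodic sequence that satisfies the recurrence along one period satisfies it everywhere, as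
soon as the coefficients have the same period. -/
lemma isLynessSequence_mod {a b : ℂ} {p : ℕ} (hp : 0 < p) (hab : Even p ∨ a = b) {v : ℕ → ℂ}
    (h : ∀ r < p, v r ≠ 0 ∧ v ((r + 2) % p) = (lynessCoeff a b r + v ((r + 1) % p)) / v r) :
    IsLynessSequence a b (fun n => v (n % p)) := by
  intro n _
  have hc : lynessCoeff a b (n % p) = lynessCoeff a b n := by
    rcases hab with hp | rfl
    · have : Odd (n % p) ↔ Odd n := by
        rw [← Nat.not_even_iff_odd, ← Nat.not_even_iff_odd, hp.mod_even_iff]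
      simp only [lynessCoeff, this]
    · simp [lynessCoeff]
  simpa [hc, Nat.add_mod] using h (n % p) (Nat.mod_lt n hp)

lemma isGloballyPeriodicLyness_zero : IsGloballyPeriodicLyness 0 0 6 := by
  refine ⟨⟨by norm_num, fun x hx n hn => hx.add_six hn⟩, fun q hq => ?_⟩
  by_contra! hlt
  obtain ⟨hq0, hq⟩ := hq
  -- The orbit of `2, 3`.
  have h := hq _ (isLynessSequence_mod (p := 6)
    (v := fun r => [2 / 3, 2, 3, 3 / 2, 1 / 2, 1 / 3].getD r 0)
    (by norm_num) (Or.inr rfl) (by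
      intro r hr
      interval_cases r <;> norm_num [lynessCoeff])) 1 le_rfl
  interval_cases q <;> norm_num at h

lemma isGloballyPeriodicLyness_one : IsGloballyPeriodicLyness 1 1 5 := by
  refine ⟨⟨by norm_num, fun x hx n hn => ?_⟩, fun q hq => ?_⟩
  · have hx' : IsLynessSequence 1 (1 ^ 2) x := by simpa using hx
    simpa [lynessCoeff] using hx'.add_five (one_pow 3) hn
  · by_contra! hlt
    obtain ⟨hq0, hq⟩ := hq
    -- The orbit of `2, 4`.
    have h := hq _ (isLynessSequence_mod (p := 5)
      (v := fun r => [3 / 4, 2, 4, 5 / 2, 7 / 8].getD r 0)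
      (by norm_num) (Or.inr rfl) (by
        intro r hr
        interval_cases r <;> norm_num [lynessCoeff])) 1 le_rfl
    interval_cases q <;> norm_num at h

lemma isGloballyPeriodicLyness_primitive_cube_root {a : ℂ} (ha : a ^ 2 + a + 1 = 0) :
    IsGloballyPeriodicLyness a (a ^ 2) 10 := by
  have ha3 : a ^ 3 = 1 := by linear_combination (a - 1) * ha
  refine ⟨⟨by norm_num, fun x hx n hn => ?_⟩, fun q hq => ?_⟩
  · have h := hx.add_five ha3 (n := n + 5) (by omega)
    rw [hx.add_five ha3 hn, add_assoc, add_assoc] at h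
    norm_num at h
    have hc : lynessCoeff a (a ^ 2) (n + 6) * lynessCoeff a (a ^ 2) (n + 1) = 1 := by
      by_cases ho : Odd n
      · simp [lynessCoeff, parity_simps, ho]
        linear_combination ha3
      · simp [lynessCoeff, parity_simps, ho]
        linear_combination ha3
    rw [h, ← mul_assoc, hc, one_mul]
  · by_contra! hlt
    obtain ⟨hq0, hq⟩ := hq
    have a0 : a ≠ 0 := by
      rintro rfl
      norm_num at ha
    have a2 : a + 2 ≠ 0 := by
      intro h
      have : (3 : ℂ) = 0 := by linear_combination ha - (a - 1) * h
      norm_num at this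
    -- The orbit of `1, 2`, simplified by `a ^ 2 + a + 1 = 0`.
    have h := hq _ (isLynessSequence_mod (p := 10) (v := fun r =>
      [-a / 2, 1, 2, a + 2, 1 / 2, -a ^ 2 / 2, a ^ 2, 2 * a, a ^ 2 * (a + 2), a / 2].getD r 0)
      (by norm_num) (Or.inl (by decide)) (by
        intro r hr
        interval_cases r <;> simp [lynessCoeff, a0, a2, eq_div_iff, Nat.odd_iff]
        · linear_combination -ha
        · linear_combination -ha
        · linear_combination -(a + 1) / 2 * ha
        · ring
        · linear_combination -a * ha
        · linear_combination (a + 2) * a * (a - 1) * ha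
        · linear_combination -a * ha
        · linear_combination -(a * (a + 1)) / 2 * ha
        · ring)) 1 le_rfl
    interval_cases q <;> norm_num at h
    · have : (1 : ℂ) = 0 := by linear_combination ha - a * h
      norm_num at this
    · have : (3 : ℂ) = 0 := by linear_combination -(a + 1) * ha - 2 * (a + 2) * h
      norm_num at this
    · rcases h with rfl | rfl <;> norm_num at ha
    · have : (7 : ℂ) = 0 := by linear_combination 4 * ha - (2 * a + 3) * h
      norm_num at this
    · exact a0 (pow_eq_zero_iff two_ne_zero |>.1 (by linear_combination (h - (a - 1) * ha) / 2))
    · have : (7 : ℂ) = 0 := by linear_combination ha - 2 * (a + 3) * h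
      norm_num at this
    · exact a2 (by linear_combination -2 * h)

/-! ### The classification -/

theorem mainTheorem3 (a b : ℂ) (p : ℕ) :
    IsGloballyPeriodicLyness a b p ↔
      (a = 0 ∧ b = 0 ∧ p = 6) ∨
      (a = 1 ∧ b = 1 ∧ p = 5) ∨
      ((a = (-1 + Complex.I * (Real.sqrt 3 : ℂ)) / 2 ∨
          a = (-1 - Complex.I * (Real.sqrt 3 : ℂ)) / 2) ∧
        b = (starRingEnd ℂ) a ∧ b = 1 / a ∧ p = 10) := by
  have h3 : (Complex.I * (Real.sqrt 3 : ℂ)) ^ 2 = -3 := by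
    rw [mul_pow, Complex.I_sq, ← Complex.ofReal_pow, Real.sq_sqrt (by norm_num)]
    norm_num
  constructor
  · intro h
    have hell : EllipticFixedPoints a b := fun x y hx hy hxy => h.1.exists_real_mul_eq hx hy hxy
    rcases hell.classify with ⟨rfl, rfl⟩ | ⟨ha, rfl⟩
    · exact Or.inl ⟨rfl, rfl, h.unique isGloballyPeriodicLyness_zero⟩
    · have hfac : (a - 1) * (a ^ 2 + a + 1) = 0 := by linear_combination ha
      rcases mul_eq_zero.1 hfac with h1 | h1
      · obtain rfl : a = 1 := sub_eq_zero.1 h1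
        rw [one_pow] at h ⊢
        exact Or.inr (Or.inl ⟨rfl, rfl, h.unique isGloballyPeriodicLyness_one⟩)
      · have ha0 : a ≠ 0 := by
          rintro rfl
          norm_num at h1
        have hinv : a ^ 2 = 1 / a := by
          rw [eq_div_iff ha0]
          linear_combination ha
        have hroots : a = (-1 + Complex.I * (Real.sqrt 3 : ℂ)) / 2 ∨
            a = (-1 - Complex.I * (Real.sqrt 3 : ℂ)) / 2 := by
          have : (a - (-1 + Complex.I * (Real.sqrt 3 : ℂ)) / 2) *
              (a - (-1 - Complex.I * (Real.sqrt 3 : ℂ)) / 2) = 0 := by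
            linear_combination h1 - h3 / 4
          exact (mul_eq_zero.1 this).imp sub_eq_zero.1 sub_eq_zero.1
        refine Or.inr (Or.inr ⟨hroots, ?_, hinv,
          h.unique (isGloballyPeriodicLyness_primitive_cube_root h1)⟩)
        rw [hinv, one_div, Complex.inv_eq_conj (Complex.norm_eq_one_of_pow_eq_one ha (by norm_num))]
  · rintro (⟨rfl, rfl, rfl⟩ | ⟨rfl, rfl, rfl⟩ | ⟨hroots, -, hb, rfl⟩)
    · exact isGloballyPeriodicLyness_zero
    · exact isGloballyPeriodicLyness_one
    · have h1 : a ^ 2 + a + 1 = 0 := by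
        rcases hroots with rfl | rfl <;> linear_combination h3 / 4
      have ha0 : a ≠ 0 := by
        rintro rfl
        norm_num at h1
      have hb' : b = a ^ 2 := by
        rw [hb, div_eq_iff ha0]
        linear_combination (1 - a) * h1
      rw [hb']
      exact isGloballyPeriodicLyness_primitive_cube_root h1
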